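/- For a simple graph $\Gamma=(V,E)$ in which every vertex has finite degree, let $d(v)$ denote the degree of $v$ and let $L$ be the normalized Laplacian, i.e. the bounded operator on $\ell^2(V)$ (square-summable functions $V\to\mathbb C$) given by $$(Lf)(v)=f(v)-\sum_{w\sim v}\frac{1}{\sqrt{d(v)d(w)}}\,f(w).$$ For $d\in\mathbb N$ let $\mathbb B^{(d)}$ be the set of bounded operators on $\ell^2(V)$ whose matrix in the standard basis $(\delta_v)_{v\in V}$ has at most $d$ nonzero entries in each row and in each column. The graph $\Gamma$ is called approximately uniformly locally finite (AULF) if $L$ lies in the operator-norm closure of $\bigcup_{d\in\mathbb N}\mathbb B^{(d)}$. Proposition. Let $K_n$ be the complete graph on $n$ vertices. The disjoint union $\bigsqcup_{n\ge 1}K_n$ is AULF. Equivalently (and so this holds as well), if $P_n$ denotes the orthogonal projection of $\mathbb C^n$ onto the line spanned by $(1,\dots,1)$, then for every $\varepsilon>0$ there is $d\in\mathbb N$ such that for every $n\ge 1$ there is a complex $n\times n$ matrix $C_n$ with at most $d$ nonzero entries in each row and in each column and with $\|P_n-C_n\|<\varepsilon$ in the operator norm of $\mathbb C^n$ with its Euclidean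 norm. -/

import Mathlib

open scoped ENNReal

noncomputable section

namespace ApproxULF

/-- The Hilbert space of square-summable complex functions on `V`. -/
abbrev ell2 (V : Type*) := lp (fun _ : V => ℂ) 2

open Classical in
/-- The entry `B_{vw} = ⟨δ_v, B δ_w⟩ = (B δ_w)(v)` of the matrix of `B` in the standard basis. -/
def matrixOf {V : Type*} (B : ell2 V →L[ℂ] ell2 V) : Matrix V V ℂ :=
  fun v w => B (lp.single 2 w 1) v

/-- Every row and every column of the matrix has at most `d` nonzero entries.
(The cardinality is the extended one, so an infinite set of entries is not allowed.) -/
def IsBanded {V : Type*} (d : ℕ) (M : Matrix V V ℂ) : Prop :=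
  (∀ v, {w | M v w ≠ 0}.encard ≤ d) ∧ (∀ w, {v | M v w ≠ 0}.encard ≤ d)

/-- The bounded operators whose matrix has at most `d` nonzero entries per row and column. -/
def bandedOperators (V : Type*) (d : ℕ) : Set (ell2 V →L[ℂ] ell2 V) :=
  {B | IsBanded d (matrixOf B)}

/-- The operator-norm closure of the union over `d` of the sets `bandedOperators V d`. -/
def approxBandedOperators (V : Type*) : Set (ell2 V →L[ℂ] ell2 V) :=
  closure (⋃ d : ℕ, bandedOperators V d)

section Laplacian

variable {V : Type*} (G : SimpleGraph V) [G.LocallyFinite]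

/-- `(A f)(v) = ∑_{w ∼ v} f(w) / √(d(v) d(w))`. At an isolated vertex the sum is empty. -/
def adjFun (f : V → ℂ) (v : V) : ℂ :=
  ∑ w ∈ G.neighborFinset v, ((1 / Real.sqrt (G.degree v * G.degree w) : ℝ) : ℂ) * f w

lemma norm_adjFun_sq_le (f : V → ℂ) (v : V) :
    ‖adjFun G f v‖ ^ 2 ≤ ∑ w ∈ G.neighborFinset v, ‖f w‖ ^ 2 / G.degree w := by
  have h1 : ‖adjFun G f v‖ ≤
      ∑ w ∈ G.neighborFinset v, (1 / Real.sqrt (G.degree v * G.degree w)) * ‖f w‖ := by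
    refine (norm_sum_le _ _).trans (Finset.sum_le_sum fun w _ => ?_)
    rw [norm_mul, Complex.norm_real, Real.norm_of_nonneg (by positivity)]
  refine (pow_le_pow_left₀ (norm_nonneg _) h1 2).trans ?_
  refine sq_sum_le_card_mul_sum_sq.trans ?_
  rw [Finset.mul_sum]
  refine Finset.sum_le_sum fun w hw => ?_
  have hv : (0 : ℝ) < G.degree v := by
    rw [SimpleGraph.mem_neighborFinset] at hw
    exact_mod_cast (G.degree_pos_iff_exists_adj v).2 ⟨w, hw⟩
  rw [SimpleGraph.card_neighborFinset_eq_degree, mul_pow, div_pow,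
    Real.sq_sqrt (by positivity), one_pow]
  apply le_of_eq
  by_cases hw0 : (G.degree w : ℝ) = 0
  · simp [hw0]
  · field_simp

lemma sum_norm_adjFun_sq_le (f : ell2 V) (s : Finset V) :
    ∑ v ∈ s, ‖adjFun G f v‖ ^ 2 ≤ ‖f‖ ^ 2 := by
  classical
  have hf : ∀ t : Finset V, ∑ w ∈ t, ‖f w‖ ^ 2 ≤ ‖f‖ ^ 2 := fun t => by
    have := lp.sum_rpow_le_norm_rpow (p := 2) (by norm_num) f t
    simpa using this
  refine le_trans ?_ (hf (s.biUnion fun v => G.neighborFinset v))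
  calc ∑ v ∈ s, ‖adjFun G f v‖ ^ 2
      ≤ ∑ v ∈ s, ∑ w ∈ G.neighborFinset v, ‖f w‖ ^ 2 / G.degree w :=
        Finset.sum_le_sum fun v _ => norm_adjFun_sq_le G f v
    _ = ∑ w ∈ (s.biUnion fun v => G.neighborFinset v), ∑ v ∈ s with G.Adj w v,
          ‖f w‖ ^ 2 / G.degree w := by
        apply Finset.sum_comm'
        intro v w
        simp only [SimpleGraph.mem_neighborFinset, Finset.mem_filter, Finset.mem_biUnion]
        constructor
        · rintro ⟨h, h'⟩
          exact ⟨⟨h, h'.symm⟩, v, h, h'⟩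
        · rintro ⟨⟨h, h'⟩, _⟩
          exact ⟨h, h'.symm⟩
    _ ≤ ∑ w ∈ (s.biUnion fun v => G.neighborFinset v), ‖f w‖ ^ 2 := by
        refine Finset.sum_le_sum fun w _ => ?_
        rw [Finset.sum_const, nsmul_eq_mul]
        have hc : ({v ∈ s | G.Adj w v}.card : ℝ) ≤ G.degree w := by
          rw [← SimpleGraph.card_neighborFinset_eq_degree]
          exact_mod_cast Finset.card_le_card fun v hv => by
            simpa using (Finset.mem_filter.1 hv).2
        rcases (Nat.cast_nonneg (α := ℝ) (G.degree w)).eq_or_lt with h0 | h0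
        · rw [← h0, div_zero, mul_zero]; positivity
        · rw [mul_div_assoc', div_le_iff₀ h0, mul_comm]
          gcongr

lemma memlp_adjFun (f : ell2 V) : Memℓp (adjFun G f) 2 :=
  memℓp_gen' (C := ‖f‖ ^ 2) fun s => by
    simpa using sum_norm_adjFun_sq_le G f s

/-- The normalized adjacency operator `A = D^{-1/2} 𝒜 D^{-1/2}` as a bounded operator. -/
def normalizedAdjacency : ell2 V →L[ℂ] ell2 V :=
  LinearMap.mkContinuous
    { toFun := fun f => ⟨adjFun G f, memlp_adjFun G f⟩
      map_add' := fun f g => by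
        ext v
        change adjFun G (f + g : ell2 V) v = adjFun G f v + adjFun G g v
        simp only [adjFun, lp.coeFn_add, Pi.add_apply, mul_add, Finset.sum_add_distrib]
      map_smul' := fun c f => by
        ext v
        simp only [adjFun, lp.coeFn_smul, Pi.smul_apply, smul_eq_mul, RingHom.id_apply,
          Finset.mul_sum]
        exact Finset.sum_congr rfl fun w _ => by ring } 1 fun f => by
    rw [one_mul]
    refine lp.norm_le_of_forall_sum_le (by norm_num) (norm_nonneg f) fun s => ?_
    simpa using sum_norm_adjFun_sq_le G f s

/-- The normalized Laplacian `L = I - A`. -/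
def normalizedLaplacian : ell2 V →L[ℂ] ell2 V :=
  ContinuousLinearMap.id ℂ (ell2 V) - normalizedAdjacency G

lemma normalizedLaplacian_apply (f : ell2 V) (v : V) :
    normalizedLaplacian G f v = f v -
      ∑ w ∈ G.neighborFinset v,
        ((1 / Real.sqrt (G.degree v * G.degree w) : ℝ) : ℂ) * f w :=
  rfl

/-- The graph is approximately uniformly locally finite. -/
def IsAULF : Prop :=
  normalizedLaplacian G ∈ approxBandedOperators V

end Laplacian

section DisjointUnion

variable {ι : Type*} {W : ι → Type*}

/-- The disjoint union of a family of graphs. -/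
def disjointUnion (G : ∀ i, SimpleGraph (W i)) : SimpleGraph (Σ i, W i) where
  Adj x y := ∃ (i : ι) (a b : W i), x = ⟨i, a⟩ ∧ y = ⟨i, b⟩ ∧ (G i).Adj a b
  symm := ⟨by
    rintro _ _ ⟨i, a, b, rfl, rfl, h⟩
    exact ⟨i, b, a, rfl, rfl, h.symm⟩⟩
  loopless := ⟨by
    rintro _ ⟨i, a, b, rfl, h, hab⟩
    obtain rfl : a = b := by simpa using h
    exact (G i).loopless.irrefl a hab⟩

instance disjointUnionLocallyFinite (G : ∀ i, SimpleGraph (W i)) [∀ i, (G i).LocallyFinite] :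
    (disjointUnion G).LocallyFinite := fun x =>
  Set.Finite.fintype <| by
    refine ((Set.toFinite ((G x.1).neighborSet x.2)).image (Sigma.mk x.1)).subset ?_
    rintro y ⟨i, a, b, rfl, rfl, h⟩
    exact ⟨b, h, rfl⟩

end DisjointUnion

/-- The disjoint union of the complete graphs `K_n` on `n` vertices. (The empty graph `K_0`
contributes no vertex, so it does not matter that `n = 0` is in the index set.) -/
abbrev unionOfCompleteGraphs : SimpleGraph (Σ n : ℕ, Fin n) :=
  disjointUnion fun n => (⊤ : SimpleGraph (Fin n))

/-- The orthogonal projection `P_n` of `ℂⁿ` onto the line spanned by `(1, …, 1)`. -/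
def constProjection (n : ℕ) : EuclideanSpace ℂ (Fin n) →L[ℂ] EuclideanSpace ℂ (Fin n) :=
  (Submodule.span ℂ {(WithLp.toLp 2 fun _ => 1 : EuclideanSpace ℂ (Fin n))}).starProjection

end ApproxULF

end

open scoped ENNReal

noncomputable section

namespace ApproxULF

open Matrix

/-! Sparse approximations of `P_n` come from an expander of bounded degree. On `(ℤ/m)²`, the
operator `torusAverage m` averages the identity with two shears and two translations. It fixes
constants and contracts mean-zero functions by the factor `1 - 1/2000`, independent of `m`. Hence
its `k`-th power, with at most `5 ^ k` nonzero entries per row and column, is within `(1 - 1/2000) ^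
k` of the projection onto constants.

The gap (`eq_zero_of_almost_invariant`) is a ping-pong argument in Fourier space. If a mean-zero `f`
is almost invariant, its transform carries no mass at `0` and, by the translations, little at large
frequencies. On small nonzero frequencies the dual shears push the cone where one coordinate
dominates into two disjoint parts of the cone where the other dominates. As the mass is almost
shear-invariant, each cone would need almost twice the mass of the other, so there is no mass at
all.

For general `n`, embed `Fin n` in a square torus with at most `4 * n` points and take a rescaled
corner (`ApproximatesMean.compress`), which costs at most a factor `4`. For the graph, off the
diagonal the Laplacian of `K_n` is `-n / (n - 1) • P_n`. Replacing `P_n` there by its sparse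
approximant is a small block diagonal perturbation. -/

/-- The bilinear pairing of `(ℤ/m)²` with itself. -/
def torusPairing {m : ℕ} (z x : ZMod m × ZMod m) : ZMod m := z.1 * x.1 + z.2 * x.2

/-- The unitary Fourier transform on `(ℤ/m)²`. -/
def torusFourier {m : ℕ} [NeZero m] (f : ZMod m × ZMod m → ℂ) (z : ZMod m × ZMod m) : ℂ :=
  (m : ℂ)⁻¹ * ∑ x, ZMod.stdAddChar (torusPairing z x) * f x

/-! ### Fourier analysis on `(ℤ/m)²`. -/

section Fourier

variable {m : ℕ} [NeZero m]

lemma sum_stdAddChar_torusPairing (x : ZMod m × ZMod m) :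
    ∑ z, (ZMod.stdAddChar (torusPairing z x) : ℂ) = if x = 0 then (m : ℂ) ^ 2 else 0 := by
  have h1 : ∀ b : ZMod m, ∑ a : ZMod m, (ZMod.stdAddChar (a * b) : ℂ) =
      if b = 0 then (m : ℂ) else 0 := fun b => by
    rw [AddChar.sum_mulShift b (ZMod.isPrimitive_stdAddChar m), ZMod.card]
    split_ifs <;> simp
  have h2 : ∑ z, (ZMod.stdAddChar (torusPairing z x) : ℂ) =
      (∑ a : ZMod m, (ZMod.stdAddChar (a * x.1) : ℂ)) * ∑ b : ZMod m, ZMod.stdAddChar (b * x.2) := by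
    rw [Finset.sum_mul_sum, Fintype.sum_prod_type]
    simp [torusPairing, AddChar.map_add_eq_mul]
  rw [h2, h1, h1]
  by_cases h : x.1 = 0 <;> by_cases h' : x.2 = 0 <;> simp [h, h', sq, Prod.ext_iff]

lemma torusFourier_parseval (f : ZMod m × ZMod m → ℂ) :
    ∑ z, ‖torusFourier f z‖ ^ 2 = ∑ x, ‖f x‖ ^ 2 := by
  have hm : (m : ℂ) ≠ 0 := Nat.cast_ne_zero.2 (NeZero.ne m)
  have key : ∀ z, ((‖torusFourier f z‖ ^ 2 : ℝ) : ℂ) = ((m : ℂ) ^ 2)⁻¹ *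
      ∑ x, ∑ y, f x * (starRingEnd ℂ) (f y) * ZMod.stdAddChar (torusPairing z (x - y)) := by
    intro z
    rw [Complex.ofReal_pow, ← Complex.mul_conj', torusFourier, map_mul, map_sum, mul_mul_mul_comm,
      Finset.sum_mul_sum]
    congr 1
    · simp [sq]
    · refine Finset.sum_congr rfl fun x _ => Finset.sum_congr rfl fun y _ => ?_
      have : torusPairing z (x - y) = torusPairing z x + -torusPairing z y := by
        simp only [torusPairing, Prod.fst_sub, Prod.snd_sub]; ring
      rw [this, AddChar.map_add_eq_mul, AddChar.map_neg_eq_conj, map_mul]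
      ring
  apply Complex.ofReal_injective
  rw [Complex.ofReal_sum, Complex.ofReal_sum, Finset.sum_congr rfl fun z _ => key z,
    ← Finset.mul_sum, Finset.sum_comm]
  rw [Finset.mul_sum]
  refine Finset.sum_congr rfl fun x _ => ?_
  rw [Finset.sum_comm, Finset.sum_eq_single x]
  · rw [← Finset.mul_sum, sum_stdAddChar_torusPairing, sub_self, if_pos rfl, Complex.ofReal_pow,
      ← Complex.mul_conj']
    field_simp
  · intro y _ hy
    rw [← Finset.mul_sum, sum_stdAddChar_torusPairing, if_neg (sub_ne_zero.2 hy.symm), mul_zero]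
  · simp

lemma torusFourier_sub (f g : ZMod m × ZMod m → ℂ) (z : ZMod m × ZMod m) :
    torusFourier (fun x => f x - g x) z = torusFourier f z - torusFourier g z := by
  simp [torusFourier, mul_sub, Finset.sum_sub_distrib]

lemma torusFourier_zero_eq (f : ZMod m × ZMod m → ℂ) (hf : ∑ x, f x = 0) :
    torusFourier f 0 = 0 := by
  simp [torusFourier, torusPairing, hf]

lemma torusFourier_translate (f : ZMod m × ZMod m → ℂ) (a z : ZMod m × ZMod m) :
    torusFourier (fun x => f (x + a)) z = ZMod.stdAddChar (-torusPairing z a) * torusFourier f z := by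
  rw [torusFourier, torusFourier, mul_left_comm,
    ← Equiv.sum_comp (Equiv.addRight a) fun x => ZMod.stdAddChar (torusPairing z x) * f x]
  congr 1
  rw [Finset.mul_sum]
  refine Finset.sum_congr rfl fun x _ => ?_
  rw [Equiv.coe_addRight, ← mul_assoc, ← AddChar.map_add_eq_mul]
  congr 2
  simp only [torusPairing, Prod.fst_add, Prod.snd_add]; ring

lemma torusFourier_comp (f : ZMod m × ZMod m → ℂ) (σ τ : Equiv.Perm (ZMod m × ZMod m))
    (h : ∀ z x, torusPairing (τ z) (σ x) = torusPairing z x) (z : ZMod m × ZMod m) :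
    torusFourier (fun x => f (σ x)) z = torusFourier f (τ z) := by
  rw [torusFourier, torusFourier, ← Equiv.sum_comp σ fun x => _ * f x]
  simp only [h]

end Fourier

/-! ### Shears, almost invariant mass and ping-pong. -/

/-- The shear `(x, y) ↦ (x + 3y, y)`. -/
def shearFst (m : ℕ) : Equiv.Perm (ZMod m × ZMod m) where
  toFun x := (x.1 + 3 * x.2, x.2)
  invFun x := (x.1 - 3 * x.2, x.2)
  left_inv x := by simp
  right_inv x := by simp

/-- The shear `(x, y) ↦ (x, y + 3x)`. -/
def shearSnd (m : ℕ) : Equiv.Perm (ZMod m × ZMod m) where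
  toFun x := (x.1, x.2 + 3 * x.1)
  invFun x := (x.1, x.2 - 3 * x.1)
  left_inv x := by simp
  right_inv x := by simp

/-- Almost invariance of `F` in `ℓ²` passes to its mass `‖F‖ ^ 2`: factor the difference of squares
and apply AM-GM with weight `η`, which balances the two error terms at `η` times the total mass
each. -/
lemma sum_norm_sq_sub_perm_le {G : Type*} [Fintype G] (F : G → ℂ) (g : Equiv.Perm G) {η : ℝ}
    (hη : 0 < η) (h : ∑ z, ‖F (g z) - F z‖ ^ 2 ≤ η ^ 2 * ∑ z, ‖F z‖ ^ 2) (E : Finset G) :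
    ∑ z ∈ E, ‖F z‖ ^ 2 - ∑ z ∈ E, ‖F (g z)‖ ^ 2 ≤ 2 * η * ∑ z, ‖F z‖ ^ 2 := by
  rw [← Finset.sum_sub_distrib]
  have pt : ∀ z, ‖F z‖ ^ 2 - ‖F (g z)‖ ^ 2 ≤ η⁻¹ * ‖F (g z) - F z‖ ^ 2 +
      (η / 2) * (‖F (g z)‖ ^ 2 + ‖F z‖ ^ 2) := fun z => by
    have h1 : ‖F z‖ - ‖F (g z)‖ ≤ ‖F (g z) - F z‖ := by
      rw [norm_sub_rev]; exact norm_sub_norm_le _ _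
    set a := ‖F z‖
    set b := ‖F (g z)‖
    set c := ‖F (g z) - F z‖
    have ha : 0 ≤ a := norm_nonneg _
    have hb : 0 ≤ b := norm_nonneg _
    have h2 : a ^ 2 - b ^ 2 ≤ c * (a + b) := by nlinarith
    have h3 : c * (a + b) ≤ η⁻¹ * c ^ 2 + η / 4 * (a + b) ^ 2 := by
      have : η⁻¹ * c ^ 2 + η / 4 * (a + b) ^ 2 - c * (a + b) =
          η⁻¹ * (c - η / 2 * (a + b)) ^ 2 := by
        field_simp; ring
      have h4 : 0 ≤ η⁻¹ * (c - η / 2 * (a + b)) ^ 2 := by positivity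
      linarith
    have h5 : η / 4 * (a + b) ^ 2 ≤ η / 2 * (b ^ 2 + a ^ 2) := by
      nlinarith [mul_nonneg hη.le (sq_nonneg (a - b))]
    linarith
  calc ∑ z ∈ E, (‖F z‖ ^ 2 - ‖F (g z)‖ ^ 2)
      ≤ ∑ z ∈ E, (η⁻¹ * ‖F (g z) - F z‖ ^ 2 + (η / 2) * (‖F (g z)‖ ^ 2 + ‖F z‖ ^ 2)) :=
        Finset.sum_le_sum fun z _ => pt z
    _ ≤ ∑ z, (η⁻¹ * ‖F (g z) - F z‖ ^ 2 + (η / 2) * (‖F (g z)‖ ^ 2 + ‖F z‖ ^ 2)) :=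
        Finset.sum_le_sum_of_subset_of_nonneg (Finset.subset_univ _) fun _ _ _ => by positivity
    _ = η⁻¹ * ∑ z, ‖F (g z) - F z‖ ^ 2 + η * ∑ z, ‖F z‖ ^ 2 := by
        rw [Finset.sum_add_distrib, ← Finset.mul_sum, ← Finset.mul_sum, Finset.sum_add_distrib,
          Equiv.sum_comp g fun z => ‖F z‖ ^ 2]
        ring
    _ ≤ η⁻¹ * (η ^ 2 * ∑ z, ‖F z‖ ^ 2) + η * ∑ z, ‖F z‖ ^ 2 := by gcongr
    _ = _ := by field_simp; ring

/-- If `g` and `g⁻¹` map `Y` to disjoint subsets of `X`, and `F` is almost invariant under `g`,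
then `X` carries almost twice the mass of `Y`. -/
lemma two_mul_sum_le_of_pingPong {G : Type*} [Fintype G] (F : G → ℂ) (g : Equiv.Perm G) {η : ℝ}
    (hη : 0 < η) (h : ∑ z, ‖F (g z) - F z‖ ^ 2 ≤ η ^ 2 * ∑ z, ‖F z‖ ^ 2) (X Y : Finset G)
    (h₁ : ∀ z ∈ Y, g z ∈ X) (h₂ : ∀ z ∈ Y, g.symm z ∈ X) (h₃ : ∀ z ∈ Y, g (g z) ∉ Y) :
    2 * ∑ z ∈ Y, ‖F z‖ ^ 2 ≤ ∑ z ∈ X, ‖F z‖ ^ 2 + 4 * η * ∑ z, ‖F z‖ ^ 2 := by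
  classical
  have h' : ∑ z, ‖F (g.symm z) - F z‖ ^ 2 ≤ η ^ 2 * ∑ z, ‖F z‖ ^ 2 := by
    rw [← Equiv.sum_comp g fun z => ‖F (g.symm z) - F z‖ ^ 2]
    simpa [norm_sub_rev] using h
  have a₁ := sum_norm_sq_sub_perm_le F g hη h Y
  have a₂ := sum_norm_sq_sub_perm_le F g.symm hη h' Y
  have hd : Disjoint (Y.map g.toEmbedding) (Y.map g.symm.toEmbedding) := by
    rw [Finset.disjoint_left]
    intro w hw hw'
    obtain ⟨y, hy, rfl⟩ := Finset.mem_map.1 hw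
    obtain ⟨y', hy', e⟩ := Finset.mem_map.1 hw'
    refine h₃ y hy ?_
    have e' : g.symm y' = g y := e
    rw [← e', Equiv.apply_symm_apply]
    exact hy'
  have hs : Y.map g.toEmbedding ∪ Y.map g.symm.toEmbedding ⊆ X := by
    intro w hw
    rcases Finset.mem_union.1 hw with hw | hw
    · obtain ⟨y, hy, rfl⟩ := Finset.mem_map.1 hw
      exact h₁ y hy
    · obtain ⟨y, hy, rfl⟩ := Finset.mem_map.1 hw
      exact h₂ y hy
  have a₃ : ∑ z ∈ Y.map g.toEmbedding ∪ Y.map g.symm.toEmbedding, ‖F z‖ ^ 2 ≤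
      ∑ z ∈ X, ‖F z‖ ^ 2 :=
    Finset.sum_le_sum_of_subset_of_nonneg hs fun _ _ _ => by positivity
  rw [Finset.sum_union hd, Finset.sum_map, Finset.sum_map] at a₃
  simp only [Equiv.coe_toEmbedding] at a₃
  linarith

lemma intCast_zmod_eq_zero_of_abs_lt {m : ℕ} {t : ℤ} (h : (t : ZMod m) = 0) (ht : |t| < m) :
    t = 0 :=
  Int.eq_zero_of_abs_lt_dvd ((ZMod.intCast_zmod_eq_zero_iff_dvd _ _).1 h) ht

lemma abs_valMinAbs_neg {m : ℕ} (a : ZMod m) : |(-a).valMinAbs| = |a.valMinAbs| := by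
  rw [Int.abs_eq_natAbs, ZMod.natAbs_valMinAbs_neg, ← Int.abs_eq_natAbs]

/-- There is no wraparound: the integers `a ± 3b` have absolute value below `4 * (m / 8) = m / 2`.
This is what fixes the threshold `m / 8`. -/
lemma valMinAbs_add_three_mul {m : ℕ} [NeZero m] {a b : ZMod m} (ha : 8 * |a.valMinAbs| < m)
    (hb : 8 * |b.valMinAbs| < m) :
    (a + 3 * b).valMinAbs = a.valMinAbs + 3 * b.valMinAbs ∧
      (a - 3 * b).valMinAbs = a.valMinAbs - 3 * b.valMinAbs := by
  rw [ZMod.valMinAbs_spec, ZMod.valMinAbs_spec]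
  push_cast
  simp only [true_and, Set.mem_Ioc]
  have := abs_lt.1 (show |a.valMinAbs| < (m + 7) / 8 by omega)
  have := abs_lt.1 (show |b.valMinAbs| < (m + 7) / 8 by omega)
  omega

/-- If `0 < |y|`, `|x| ≤ |y|` and both are small, the shear `x ↦ x ± 3y` makes `x` dominate `y`,
and `x + 6y` is either large or dominates `y`. -/
lemma shear_dominates {m : ℕ} [NeZero m] {a b : ZMod m} (ha : 8 * |a.valMinAbs| < m)
    (hb : 8 * |b.valMinAbs| < m) (h0 : b ≠ 0) (hab : |a.valMinAbs| ≤ |b.valMinAbs|) :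
    |b.valMinAbs| < |(a + 3 * b).valMinAbs| ∧ |b.valMinAbs| < |(a - 3 * b).valMinAbs| ∧
      (8 * |(a + 3 * b + 3 * b).valMinAbs| < m →
        |b.valMinAbs| < |(a + 3 * b + 3 * b).valMinAbs|) := by
  have hb0 : b.valMinAbs ≠ 0 := fun h => h0 ((ZMod.valMinAbs_eq_zero b).1 h)
  obtain ⟨h1, h2⟩ := valMinAbs_add_three_mul ha hb
  -- The multiplier `3` gives `|a ± 3b| ≥ 2|b| > |b|`. The integer `a + 6b` may wrap around, but its
  -- absolute value is below `7m/8`; if its residue is smaller than `m/8`, the two differ by less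
  -- than `m`, hence agree, and `|a + 6b| ≥ 5|b|`.
  refine ⟨by rw [h1]; grind, by rw [h2]; grind, fun h3 => ?_⟩
  have : (a + 3 * b + 3 * b).valMinAbs - (a.valMinAbs + 6 * b.valMinAbs) = 0 := by
    apply intCast_zmod_eq_zero_of_abs_lt (m := m)
    · push_cast
      ring
    · grind
  grind

/-- The character value is `exp (i t)` with `π / 4 ≤ |t| ≤ π`, so the squared distance to `1` is `2
- 2 cos t ≥ 2 - √2 > 2 - 1.42 = 29 / 50`. -/
lemma le_norm_stdAddChar_sub_one_sq {m : ℕ} [NeZero m] (a : ZMod m)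
    (ha : (m : ℤ) ≤ 8 * |a.valMinAbs|) :
    (29 / 50 : ℝ) ≤ ‖(ZMod.stdAddChar a : ℂ) - 1‖ ^ 2 := by
  have hm : (0 : ℝ) < m := Nat.cast_pos.2 (NeZero.pos m)
  set t : ℝ := 2 * Real.pi * a.valMinAbs / m with ht
  have e : (ZMod.stdAddChar a : ℂ) = Complex.exp (t * Complex.I) := by
    conv_lhs => rw [← ZMod.coe_valMinAbs a, ZMod.stdAddChar_coe]
    rw [ht]; push_cast; congr 1; ring
  have e2 : ‖(ZMod.stdAddChar a : ℂ) - 1‖ ^ 2 = 2 - 2 * Real.cos t := by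
    rw [e, ← Complex.normSq_eq_norm_sq, Complex.normSq_apply]
    simp only [Complex.sub_re, Complex.sub_im, Complex.exp_ofReal_mul_I_re,
      Complex.exp_ofReal_mul_I_im, Complex.one_re, Complex.one_im]
    nlinarith [Real.sin_sq_add_cos_sq t]
  have habs : |t| = 2 * Real.pi * |(a.valMinAbs : ℝ)| / m := by
    rw [ht, abs_div, abs_mul, abs_of_pos Real.two_pi_pos, abs_of_pos hm]
  have h1 : Real.pi / 4 ≤ |t| := by
    have : (m : ℝ) ≤ 8 * |(a.valMinAbs : ℝ)| := by exact_mod_cast ha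
    rw [habs, le_div_iff₀ hm]
    nlinarith [Real.pi_pos]
  have h2 : |t| ≤ Real.pi := by
    have h := ZMod.valMinAbs_mem_Ioc a
    have : |a.valMinAbs| * 2 ≤ m := by
      have := h.1; have := h.2; grind
    have : |(a.valMinAbs : ℝ)| * 2 ≤ m := by exact_mod_cast this
    rw [habs, div_le_iff₀ hm]
    nlinarith [Real.pi_pos]
  have h3 : Real.cos t ≤ √2 / 2 := by
    rw [← Real.cos_abs, ← Real.cos_pi_div_four]
    exact Real.cos_le_cos_of_nonneg_of_le_pi (by positivity) h2 h1
  have h4 : √2 < 1.42 := by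
    rw [Real.sqrt_lt' (by norm_num)]; norm_num
  rw [e2]; linarith

/-- A shear acting on frequencies is contragredient to the inverse of the other shear acting on
points; this is why `torusGenerator` contains inverse shears. -/
lemma shearFst_pairing {m : ℕ} (z x : ZMod m × ZMod m) :
    torusPairing (shearFst m z) ((shearSnd m).symm x) = torusPairing z x := by
  simp only [torusPairing, shearFst, shearSnd, Equiv.coe_fn_mk, Equiv.coe_fn_symm_mk]; ring

lemma shearSnd_pairing {m : ℕ} (z x : ZMod m × ZMod m) :
    torusPairing (shearSnd m z) ((shearFst m).symm x) = torusPairing z x := by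
  simp only [torusPairing, shearFst, shearSnd, Equiv.coe_fn_mk, Equiv.coe_fn_symm_mk]; ring

/-! ### The spectral gap on the torus. -/

section Gap

variable {m : ℕ} [NeZero m]

lemma sum_norm_torusFourier_comp_sub (f : ZMod m × ZMod m → ℂ)
    (σ τ : Equiv.Perm (ZMod m × ZMod m))
    (h : ∀ z x, torusPairing (τ z) (σ x) = torusPairing z x) :
    ∑ z, ‖torusFourier f (τ z) - torusFourier f z‖ ^ 2 = ∑ x, ‖f (σ x) - f x‖ ^ 2 := by
  rw [← torusFourier_parseval fun x => f (σ x) - f x]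
  simp_rw [torusFourier_sub, torusFourier_comp f σ τ h]

/-- A translation-almost-invariant function has little Fourier mass at the frequencies which the
translation moves. -/
lemma sum_torusFourier_le_of_translate (f : ZMod m × ZMod m → ℂ) (a : ZMod m × ZMod m)
    (E : Finset (ZMod m × ZMod m))
    (hE : ∀ z ∈ E, (m : ℤ) ≤ 8 * |(torusPairing z (-a)).valMinAbs|) :
    29 / 50 * ∑ z ∈ E, ‖torusFourier f z‖ ^ 2 ≤ ∑ x, ‖f (x + a) - f x‖ ^ 2 := by
  rw [← torusFourier_parseval, Finset.mul_sum]
  refine le_trans (Finset.sum_le_sum fun z hz => ?_)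
    (Finset.sum_le_sum_of_subset_of_nonneg (Finset.subset_univ E) fun _ _ _ => by positivity)
  rw [torusFourier_sub, torusFourier_translate, ← sub_one_mul, norm_mul, mul_pow]
  gcongr
  refine le_norm_stdAddChar_sub_one_sq _ ?_
  convert hE z hz using 4
  simp only [torusPairing, Prod.fst_neg, Prod.snd_neg]; ring

/-- The four permutations of `(ℤ/m)²` whose almost invariant functions are almost constant. -/
def torusGenerator (m : ℕ) : Fin 4 → Equiv.Perm (ZMod m × ZMod m) :=
  ![(shearSnd m).symm, (shearFst m).symm, Equiv.addRight (1, 0), Equiv.addRight (0, 1)]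

/-- `B₁` and `B₂` hold the large frequencies; `X'` and `Y'` are the small nonzero ones in the two
closed cones, and `X`, `Y` the disjoint open cones. Ping-pong sends `Y'` into `X` and `X'` into `Y`.
-/
theorem eq_zero_of_almost_invariant (f : ZMod m × ZMod m → ℂ) (hf : ∑ x, f x = 0)
    (h : ∀ i, ∑ x, ‖f (torusGenerator m i x) - f x‖ ^ 2 ≤ (1 / 10) ^ 2 * ∑ x, ‖f x‖ ^ 2) :
    ∑ x, ‖f x‖ ^ 2 = 0 := by
  set S := ∑ x, ‖f x‖ ^ 2 with hS
  set F := torusFourier f with hF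
  have hP : ∑ z, ‖F z‖ ^ 2 = S := torusFourier_parseval f
  let B₁ : Finset (ZMod m × ZMod m) := {z | (m : ℤ) ≤ 8 * |z.1.valMinAbs|}
  let B₂ : Finset (ZMod m × ZMod m) := {z | (m : ℤ) ≤ 8 * |z.2.valMinAbs|}
  let X : Finset (ZMod m × ZMod m) := {z | |z.2.valMinAbs| < |z.1.valMinAbs|}
  let Y : Finset (ZMod m × ZMod m) := {z | |z.1.valMinAbs| < |z.2.valMinAbs|}
  let X' : Finset (ZMod m × ZMod m) := {z | 8 * |z.1.valMinAbs| < m ∧ 8 * |z.2.valMinAbs| < m ∧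
    z.1 ≠ 0 ∧ |z.2.valMinAbs| ≤ |z.1.valMinAbs|}
  let Y' : Finset (ZMod m × ZMod m) := {z | 8 * |z.1.valMinAbs| < m ∧ 8 * |z.2.valMinAbs| < m ∧
    z.2 ≠ 0 ∧ |z.1.valMinAbs| ≤ |z.2.valMinAbs|}
  have b₁ := sum_torusFourier_le_of_translate f (1, 0) B₁ fun z hz => by
    simpa [torusPairing, B₁, abs_valMinAbs_neg] using hz
  have b₂ := sum_torusFourier_le_of_translate f (0, 1) B₂ fun z hz => by
    simpa [torusPairing, B₂, abs_valMinAbs_neg] using hz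
  have h₀ := h 0
  have h₁ := h 1
  have h₂ := h 2
  have h₃ := h 3
  simp only [torusGenerator, Matrix.cons_val, Equiv.coe_addRight] at h₀ h₁ h₂ h₃
  -- By Parseval, almost invariance of `f` under a spatial shear is almost invariance of `F` under
  -- the dual shear.
  rw [← sum_norm_torusFourier_comp_sub f _ _ shearFst_pairing, ← hP] at h₀
  rw [← sum_norm_torusFourier_comp_sub f _ _ shearSnd_pairing, ← hP] at h₁
  have p₁ := two_mul_sum_le_of_pingPong F (shearFst m) (by norm_num) h₀ X Y'
    (fun z hz => by
      obtain ⟨u1, u2, u3, u4⟩ := (Finset.mem_filter.1 hz).2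
      simpa [X, shearFst] using (shear_dominates u1 u2 u3 u4).1)
    (fun z hz => by
      obtain ⟨u1, u2, u3, u4⟩ := (Finset.mem_filter.1 hz).2
      simpa [X, shearFst] using (shear_dominates u1 u2 u3 u4).2.1)
    (fun z hz hz' => by
      obtain ⟨u1, u2, u3, u4⟩ := (Finset.mem_filter.1 hz).2
      obtain ⟨v1, v2, v3, v4⟩ := (Finset.mem_filter.1 hz').2
      exact absurd v4 (not_le.2 ((shear_dominates u1 u2 u3 u4).2.2 v1)))
  have p₂ := two_mul_sum_le_of_pingPong F (shearSnd m) (by norm_num) h₁ Y X'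
    (fun z hz => by
      obtain ⟨u1, u2, u3, u4⟩ := (Finset.mem_filter.1 hz).2
      simpa [Y, shearSnd] using (shear_dominates u2 u1 u3 u4).1)
    (fun z hz => by
      obtain ⟨u1, u2, u3, u4⟩ := (Finset.mem_filter.1 hz).2
      simpa [Y, shearSnd] using (shear_dominates u2 u1 u3 u4).2.1)
    (fun z hz hz' => by
      obtain ⟨u1, u2, u3, u4⟩ := (Finset.mem_filter.1 hz).2
      obtain ⟨v1, v2, v3, v4⟩ := (Finset.mem_filter.1 hz').2
      exact absurd v4 (not_le.2 ((shear_dominates u2 u1 u3 u4).2.2 v2)))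
  have hXY : ∑ z ∈ X, ‖F z‖ ^ 2 + ∑ z ∈ Y, ‖F z‖ ^ 2 ≤ ∑ z, ‖F z‖ ^ 2 := by
    rw [← Finset.sum_union (Finset.disjoint_filter.2 fun z _ h => not_lt.2 h.le)]
    exact Finset.sum_le_sum_of_subset_of_nonneg (Finset.subset_univ _) fun _ _ _ => by positivity
  -- A nonzero frequency is large in some coordinate or lies in `X'` or `Y'`, where ties are
  -- allowed; the frequency `0` has no mass because `f` has mean zero.
  have hcov : ∑ z, ‖F z‖ ^ 2 ≤ ∑ z ∈ X', ‖F z‖ ^ 2 + ∑ z ∈ Y', ‖F z‖ ^ 2 +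
      (∑ z ∈ B₁, ‖F z‖ ^ 2 + ∑ z ∈ B₂, ‖F z‖ ^ 2) := by
    simp only [X', Y', B₁, B₂, Finset.sum_filter, ← Finset.sum_add_distrib]
    refine Finset.sum_le_sum fun z _ => ?_
    have hn : 0 ≤ ‖F z‖ ^ 2 := by positivity
    by_cases hz : z.1 = 0 ∧ z.2 = 0
    · have : F z = 0 := by
        rw [show z = 0 from Prod.ext hz.1 hz.2]; exact torusFourier_zero_eq f hf
      simp [this]
    · have e1 := ZMod.valMinAbs_eq_zero z.1
      have e2 := ZMod.valMinAbs_eq_zero z.2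
      grind
  have hS0 : 0 ≤ S := Finset.sum_nonneg fun _ _ => by positivity
  have b₁' := b₁.trans h₂
  have b₂' := b₂.trans h₃
  rw [hP] at *
  -- With `η = 1/10`, adding `p₁` and `p₂` bounds the mass of `X'` and `Y'` by `(1 + 8/10) / 2 * S =
  -- 9/10 * S`, while `B₁` and `B₂` together carry at most `2 * (50/29) / 100 * S = S / 29`. The sum
  -- is below `S` unless `S = 0`.
  linarith

end Gap

/-! ### The averaging operator and its contraction. -/

/-- If the sum of five vectors of equal norm is almost as long as possible, they are almost
equal. -/
lemma norm_sub_sq_le_of_le_norm_sum {H : Type*} [NormedAddCommGroup H] [InnerProductSpace ℂ H]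
    (u₀ : H) (u : Fin 4 → H) (hu : ∀ i, ‖u i‖ = ‖u₀‖) {δ : ℝ} (hδ : δ ≤ 2 / 5)
    (h : 5 * ((1 - δ) * ‖u₀‖) ≤ ‖u₀ + ∑ i, u i‖) (i : Fin 4) :
    ‖u i - u₀‖ ^ 2 ≤ 20 * δ * ‖u₀‖ ^ 2 := by
  have h1 : ‖u₀ + ∑ j, u j‖ ≤ ‖u i + u₀‖ + 3 * ‖u₀‖ := by
    rw [← Finset.add_sum_erase _ _ (Finset.mem_univ i), ← add_assoc, add_comm u₀]
    refine (norm_add_le _ _).trans (add_le_add_right ((norm_sum_le _ _).trans ?_) _)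
    simp [hu, Finset.card_erase_of_mem]
  -- Three of the vectors contribute at most `3 * ‖u₀‖`, so `u i + u₀` is almost as long as
  -- possible; the parallelogram law then makes `u i - u₀` short.
  have h2 : (2 - 5 * δ) * ‖u₀‖ ≤ ‖u i + u₀‖ := by linarith
  have h3 := parallelogram_law_with_norm ℂ (u i) u₀
  rw [hu] at h3
  have h4 : ((2 - 5 * δ) * ‖u₀‖) ^ 2 ≤ ‖u i + u₀‖ ^ 2 :=
    pow_le_pow_left₀ (mul_nonneg (by linarith) (norm_nonneg _)) h2 2
  nlinarith [sq_nonneg (δ * ‖u₀‖)]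

/-- The average of the identity and of the permutation matrices of the generators. -/
def torusAverage (m : ℕ) [NeZero m] : Matrix (ZMod m × ZMod m) (ZMod m × ZMod m) ℂ :=
  (1 / 5 : ℂ) • (1 + ∑ i, (torusGenerator m i).permMatrix ℂ)

section Average

variable {m : ℕ} [NeZero m]

lemma torusAverage_mulVec (f : ZMod m × ZMod m → ℂ) :
    torusAverage m *ᵥ f = (1 / 5 : ℂ) • (f + ∑ i, f ∘ torusGenerator m i) := by
  rw [torusAverage, smul_mulVec, add_mulVec, one_mulVec, sum_mulVec]
  simp [permMatrix_mulVec]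

lemma sum_torusAverage_mulVec (f : ZMod m × ZMod m → ℂ) :
    ∑ x, (torusAverage m *ᵥ f) x = ∑ x, f x := by
  simp only [torusAverage_mulVec, Pi.smul_apply, Pi.add_apply, Finset.sum_apply,
    Function.comp_apply, smul_eq_mul]
  rw [← Finset.mul_sum, Finset.sum_add_distrib, Finset.sum_comm]
  simp only [Equiv.sum_comp _ f, Finset.sum_const, Finset.card_univ, Fintype.card_fin,
    nsmul_eq_mul]
  push_cast; ring

lemma torusAverage_mulVec_const (c : ℂ) :
    torusAverage m *ᵥ (fun _ => c) = fun _ => c := by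
  ext x
  simp only [torusAverage_mulVec, Pi.smul_apply, Pi.add_apply, Finset.sum_apply,
    Function.comp_apply, Finset.sum_const, Finset.card_univ, Fintype.card_fin, nsmul_eq_mul,
    smul_eq_mul]
  push_cast; ring

lemma norm_torusAverage_le (f : ZMod m × ZMod m → ℂ) (hf : ∑ x, f x = 0) :
    ‖WithLp.toLp 2 (torusAverage m *ᵥ f)‖ ≤ (1 - 1 / 2000) * ‖WithLp.toLp 2 f‖ := by
  by_contra! hlt
  have hnorm : ∀ i, ‖WithLp.toLp 2 (f ∘ torusGenerator m i)‖ = ‖WithLp.toLp 2 f‖ := fun i => by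
    simp only [EuclideanSpace.norm_eq, Function.comp_apply]
    rw [Equiv.sum_comp _ fun x => ‖f x‖ ^ 2]
  have e : WithLp.toLp 2 (torusAverage m *ᵥ f) = (1 / 5 : ℂ) • (WithLp.toLp 2 f +
      ∑ i, WithLp.toLp 2 (f ∘ torusGenerator m i)) := by
    rw [torusAverage_mulVec, WithLp.toLp_smul, WithLp.toLp_add, WithLp.toLp_sum]
  have h1 : ‖WithLp.toLp 2 (torusAverage m *ᵥ f)‖ = 1 / 5 * ‖WithLp.toLp 2 f +
      ∑ i, WithLp.toLp 2 (f ∘ torusGenerator m i)‖ := by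
    rw [e, norm_smul]; norm_num
  -- The value of `δ` is chosen so that `20 * δ = (1 / 10) ^ 2`, the tolerance in
  -- `eq_zero_of_almost_invariant`.
  have h2 := norm_sub_sq_le_of_le_norm_sum (WithLp.toLp 2 f)
    (fun i => WithLp.toLp 2 (f ∘ torusGenerator m i)) hnorm (δ := 1 / 2000) (by norm_num)
    (by linarith)
  have h3 := eq_zero_of_almost_invariant f hf fun i => by
    have := h2 i
    rw [← WithLp.toLp_sub, EuclideanSpace.norm_sq_eq, EuclideanSpace.norm_sq_eq] at this
    refine le_trans this (le_of_eq ?_)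
    norm_num
  have h4 : f = 0 := by
    ext x
    have := (Finset.sum_eq_zero_iff_of_nonneg fun _ _ => by positivity).1 h3 x (Finset.mem_univ x)
    simpa using this
  rw [h4] at hlt
  simp at hlt

end Average

/-! ### Approximating the mean, on the torus and on subsets. -/

/-- The matrix `C` is within `ε`, in the operator norm of `ℓ²(V)`, of the projection onto the
constant functions. -/
def ApproximatesMean {V : Type*} [Fintype V] (C : Matrix V V ℂ) (ε : ℝ) : Prop :=
  ∀ f : V → ℂ, ∑ v, ‖(∑ w, f w) / Fintype.card V - (C *ᵥ f) v‖ ^ 2 ≤ ε ^ 2 * ∑ v, ‖f v‖ ^ 2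

lemma sum_norm_sub_mean_sq_le {V : Type*} [Fintype V] [Nonempty V] (f : V → ℂ) :
    ∑ v, ‖f v - (∑ w, f w) / Fintype.card V‖ ^ 2 ≤ ∑ v, ‖f v‖ ^ 2 := by
  set c := (∑ w, f w) / Fintype.card V with hc
  have hs : ∑ w, f w = Fintype.card V * c := by
    rw [hc]; field_simp
  have h : ∑ v, ‖f v - c‖ ^ 2 = ∑ v, ‖f v‖ ^ 2 - Fintype.card V * ‖c‖ ^ 2 := by
    simp only [← Complex.normSq_eq_norm_sq, Complex.normSq_sub, Finset.sum_sub_distrib,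
      Finset.sum_add_distrib, Finset.sum_const, Finset.card_univ, nsmul_eq_mul, ← Finset.mul_sum,
      ← Complex.re_sum, ← Finset.sum_mul, hs, mul_assoc, Complex.mul_conj, ← Complex.ofReal_natCast,
      ← Complex.ofReal_mul, Complex.ofReal_re]
    ring
  rw [h]
  have : 0 ≤ (Fintype.card V : ℝ) * ‖c‖ ^ 2 := by positivity
  linarith

/-- The average fixes constants, so the error on `f` is minus the power applied to `f` with its mean
removed. Mean zero is preserved, so the contraction iterates, and removing the mean does not
increase the norm. -/
lemma approximatesMean_torusAverage_pow (m k : ℕ) [NeZero m] :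
    ApproximatesMean (torusAverage m ^ k) ((1 - 1 / 2000) ^ k) := by
  have hconst : ∀ (k : ℕ) (c : ℂ), (torusAverage m ^ k) *ᵥ (fun _ => c) = fun _ => c := by
    intro k c
    induction k with
    | zero => simp
    | succ k ih => rw [pow_succ, ← mulVec_mulVec, torusAverage_mulVec_const, ih]
  have hcontr : ∀ (k : ℕ) (f : ZMod m × ZMod m → ℂ), ∑ x, f x = 0 →
      ‖WithLp.toLp 2 ((torusAverage m ^ k) *ᵥ f)‖ ≤ (1 - 1 / 2000) ^ k * ‖WithLp.toLp 2 f‖ := by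
    intro k
    induction k with
    | zero => intro f _; simp
    | succ k ih =>
      intro f hf
      rw [pow_succ, ← mulVec_mulVec, pow_succ, mul_assoc]
      refine (ih _ (by rw [sum_torusAverage_mulVec, hf])).trans ?_
      exact mul_le_mul_of_nonneg_left (norm_torusAverage_le f hf) (by norm_num)
  intro f
  set c := (∑ w, f w) / Fintype.card (ZMod m × ZMod m) with hc
  have hg : ∑ x, (f x - c) = 0 := by
    rw [Finset.sum_sub_distrib, Finset.sum_const, nsmul_eq_mul, Finset.card_univ, hc,
      mul_div_cancel₀ _ (Nat.cast_ne_zero.2 Fintype.card_ne_zero), sub_self]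
  have e : ∀ v, c - ((torusAverage m ^ k) *ᵥ f) v =
      -((torusAverage m ^ k) *ᵥ fun x => f x - c) v := fun v => by
    have : (fun x => f x - c) = f - fun _ => c := rfl
    rw [this, mulVec_sub, hconst]
    simp
  have h1 := pow_le_pow_left₀ (norm_nonneg _) (hcontr k _ hg) 2
  rw [mul_pow, EuclideanSpace.norm_sq_eq, EuclideanSpace.norm_sq_eq] at h1
  simp only [e, norm_neg]
  refine h1.trans ?_
  gcongr ?_ * ?_
  exact sum_norm_sub_mean_sq_le f

/-- The corner on `V` of the mean projection of `W` is `|V| / |W|` times that of `V`. Extending by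
zero, applying `C` and restricting does not increase the error; undoing the factor multiplies it by
`|W| / |V| ≤ K`. -/
lemma ApproximatesMean.compress {V W : Type*} [Fintype V] [Fintype W] [Nonempty V]
    {C : Matrix W W ℂ} {ε : ℝ} (hC : ApproximatesMean C ε) (e : V ↪ W) {K : ℝ}
    (hK : (Fintype.card W : ℝ) ≤ K * Fintype.card V) :
    ApproximatesMean (((Fintype.card W : ℂ) / Fintype.card V) • C.submatrix e e) (K * ε) := by
  classical
  intro f
  have hV : (0 : ℝ) < Fintype.card V := by exact_mod_cast Fintype.card_pos
  have : Nonempty W := ⟨e (Classical.arbitrary V)⟩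
  set F : W → ℂ := Function.extend e f 0 with hF
  have hFe : ∀ v, F (e v) = f v := fun v => e.injective.extend_apply f 0 v
  have hF0 : ∀ w, w ∉ Set.range e → F w = 0 := fun w hw => by
    rw [hF, Function.extend_apply' _ _ _ (by simpa using hw), Pi.zero_apply]
  have hsum : ∑ w, F w = ∑ v, f v := by
    rw [← Finset.sum_subset (Finset.subset_univ (Finset.univ.map e)), Finset.sum_map]
    · simp only [hFe]
    · intro w _ hw; exact hF0 w (by simpa using hw)
  have hnorm : ∑ w, ‖F w‖ ^ 2 = ∑ v, ‖f v‖ ^ 2 := by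
    rw [← Finset.sum_subset (Finset.subset_univ (Finset.univ.map e)), Finset.sum_map]
    · simp only [hFe]
    · intro w _ hw; rw [hF0 w (by simpa using hw)]; simp
  have hmul : ∀ v, (C.submatrix e e *ᵥ f) v = (C *ᵥ F) (e v) := fun v => by
    simp only [mulVec, dotProduct, submatrix_apply]
    rw [← Finset.sum_subset (Finset.subset_univ (Finset.univ.map e)), Finset.sum_map]
    · simp only [hFe]
    · intro w _ hw; rw [hF0 w (by simpa using hw), mul_zero]
  have hr : (Fintype.card W : ℝ) / Fintype.card V ≤ K := (div_le_iff₀ hV).2 hK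
  have h1 : ∀ v, ‖(∑ w, f w) / Fintype.card V -
      ((((Fintype.card W : ℂ) / Fintype.card V) • C.submatrix e e) *ᵥ f) v‖ ^ 2 =
      ((Fintype.card W : ℝ) / Fintype.card V) ^ 2 *
        ‖(∑ w, F w) / Fintype.card W - (C *ᵥ F) (e v)‖ ^ 2 := fun v => by
    have : (∑ w, f w) / Fintype.card V -
        ((((Fintype.card W : ℂ) / Fintype.card V) • C.submatrix e e) *ᵥ f) v =
        ((Fintype.card W : ℂ) / Fintype.card V) *
          ((∑ w, F w) / Fintype.card W - (C *ᵥ F) (e v)) := by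
      rw [smul_mulVec, Pi.smul_apply, hmul, hsum, smul_eq_mul]
      field_simp
    rw [this, norm_mul, mul_pow]
    simp
  simp only [h1, ← Finset.mul_sum]
  rw [mul_pow, mul_assoc]
  gcongr ?_ ^ 2 * ?_
  calc ∑ v, ‖(∑ w, F w) / Fintype.card W - (C *ᵥ F) (e v)‖ ^ 2
      = ∑ w ∈ Finset.univ.map e, ‖(∑ w, F w) / Fintype.card W - (C *ᵥ F) w‖ ^ 2 := by
        rw [Finset.sum_map]
    _ ≤ ∑ w, ‖(∑ w, F w) / Fintype.card W - (C *ᵥ F) w‖ ^ 2 :=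
        Finset.sum_le_sum_of_subset_of_nonneg (Finset.subset_univ _) fun _ _ _ => by positivity
    _ ≤ ε ^ 2 * ∑ v, ‖f v‖ ^ 2 := by rw [← hnorm]; exact hC F

/-! ### Sparsity under matrix operations. -/

section Banded

variable {V W : Type*}

lemma IsBanded.transpose {d : ℕ} {M : Matrix V V ℂ} (h : IsBanded d M) : IsBanded d Mᵀ :=
  ⟨h.2, h.1⟩

/-- Columns are rows of the transpose, so for sums and products only the row bound needs an
argument. -/
lemma isBanded_of_row_of_transpose {d : ℕ} {M : Matrix V V ℂ}
    (h : ∀ v, {w | M v w ≠ 0}.encard ≤ d) (h' : ∀ v, {w | Mᵀ v w ≠ 0}.encard ≤ d) :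
    IsBanded d M :=
  ⟨h, h'⟩

lemma IsBanded.add {d d' : ℕ} {M M' : Matrix V V ℂ} (h : IsBanded d M) (h' : IsBanded d' M') :
    IsBanded (d + d') (M + M') := by
  have key : ∀ {M M' : Matrix V V ℂ}, IsBanded d M → IsBanded d' M' → ∀ v,
      {w | (M + M') v w ≠ 0}.encard ≤ (d + d' : ℕ) := fun {M M'} h h' v => by
    refine (Set.encard_le_encard (t := {w | M v w ≠ 0} ∪ {w | M' v w ≠ 0}) ?_).trans
      ((Set.encard_union_le _ _).trans ?_)
    · intro w hw
      by_contra hc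
      simp only [Set.mem_union, Set.mem_ofPred_eq, not_or, not_not] at hc
      exact hw (by rw [Matrix.add_apply, hc.1, hc.2, add_zero])
    · push_cast; exact add_le_add (h.1 v) (h'.1 v)
  exact isBanded_of_row_of_transpose (key h h') (key h.transpose h'.transpose)

lemma IsBanded.smul {d : ℕ} {M : Matrix V V ℂ} (h : IsBanded d M) (c : ℂ) :
    IsBanded d (c • M) := by
  refine ⟨fun v => (Set.encard_le_encard fun w hw => ?_).trans (h.1 v),
    fun v => (Set.encard_le_encard fun w hw => ?_).trans (h.2 v)⟩ <;>
  exact right_ne_zero_of_smul (show c • _ ≠ 0 from hw)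

lemma IsBanded.submatrix {d : ℕ} {M : Matrix W W ℂ} (h : IsBanded d M) (e : V ↪ W) :
    IsBanded d (M.submatrix e e) := by
  refine ⟨fun v => ?_, fun v => ?_⟩
  · rw [← e.injective.encard_image]
    refine (Set.encard_le_encard ?_).trans (h.1 (e v))
    rintro _ ⟨w, hw, rfl⟩; exact hw
  · rw [← e.injective.encard_image]
    refine (Set.encard_le_encard ?_).trans (h.2 (e v))
    rintro _ ⟨w, hw, rfl⟩; exact hw

lemma IsBanded.mul [Fintype V] {d d' : ℕ} {M M' : Matrix V V ℂ} (h : IsBanded d M)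
    (h' : IsBanded d' M') : IsBanded (d * d') (M * M') := by
  have key : ∀ {d d' : ℕ} {M M' : Matrix V V ℂ}, IsBanded d M → IsBanded d' M' → ∀ v,
      {w | (M * M') v w ≠ 0}.encard ≤ (d * d' : ℕ) := fun {d d' M M'} h h' v => by
    classical
    set t : Finset V := {u | M v u ≠ 0} with ht
    have hcard : t.card ≤ d := by
      have := h.1 v
      rw [show {w | M v w ≠ 0} = (t : Set V) by ext; simp [ht], Set.encard_coe_eq_coe_finsetCard]
        at this
      exact_mod_cast this
    calc {w | (M * M') v w ≠ 0}.encard ≤ (⋃ u ∈ t, {w | M' u w ≠ 0}).encard := by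
          refine Set.encard_le_encard fun w hw => ?_
          obtain ⟨u, _, hu⟩ := Finset.exists_ne_zero_of_sum_ne_zero hw
          simp only [Set.mem_iUnion]
          exact ⟨u, by simpa [ht] using left_ne_zero_of_mul hu, right_ne_zero_of_mul hu⟩
      _ ≤ ∑ u ∈ t, {w | M' u w ≠ 0}.encard := t.set_encard_biUnion_le _
      _ ≤ ∑ u ∈ t, (d' : ℕ∞) := Finset.sum_le_sum fun u _ => h'.1 u
      _ = t.card * d' := by rw [Finset.sum_const, nsmul_eq_mul]
      _ ≤ (d * d' : ℕ) := by exact_mod_cast Nat.mul_le_mul_right _ hcard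
  refine isBanded_of_row_of_transpose (key h h') ?_
  rw [Matrix.transpose_mul, mul_comm d]
  exact key h'.transpose h.transpose

lemma isBanded_permMatrix [DecidableEq V] (σ : Equiv.Perm V) :
    IsBanded 1 (σ.permMatrix ℂ) := by
  refine ⟨fun v => ?_, fun v => ?_⟩
  · refine (Set.encard_le_encard (t := {σ v}) fun w hw => ?_).trans (by simp)
    by_contra hc
    exact hw (by simp [Equiv.Perm.permMatrix, PEquiv.toMatrix_apply, Ne.symm hc])
  · refine (Set.encard_le_encard (t := {σ.symm v}) fun w hw => ?_).trans (by simp)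
    by_contra hc
    refine hw ?_
    have : σ w ≠ v := fun h => hc (by simp [← h])
    simp [Equiv.Perm.permMatrix, PEquiv.toMatrix_apply, this]

lemma isBanded_one [DecidableEq V] : IsBanded 1 (1 : Matrix V V ℂ) := by
  simpa using isBanded_permMatrix (1 : Equiv.Perm V)

lemma IsBanded.pow [Fintype V] [DecidableEq V] {d : ℕ} {M : Matrix V V ℂ} (h : IsBanded d M)
    (k : ℕ) : IsBanded (d ^ k) (M ^ k) := by
  induction k with
  | zero => simpa using isBanded_one
  | succ k ih => rw [pow_succ, pow_succ]; exact ih.mul h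

lemma isBanded_torusAverage (m : ℕ) [NeZero m] : IsBanded 5 (torusAverage m) := by
  refine IsBanded.smul ?_ _
  simp only [Fin.sum_univ_four]
  exact isBanded_one.add (((isBanded_permMatrix _).add (isBanded_permMatrix _)).add
    (isBanded_permMatrix _) |>.add (isBanded_permMatrix _))

end Banded

/-- The projections onto the constants are approximated, uniformly in the dimension, by matrices
with boundedly many nonzero entries in each row and column. -/
theorem exists_banded_approximatesMean {ε : ℝ} (hε : 0 < ε) :
    ∃ d : ℕ, ∀ n : ℕ, 1 ≤ n → ∃ C : Matrix (Fin n) (Fin n) ℂ,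
      IsBanded d C ∧ ApproximatesMean C ε := by
  -- The divisor `4` pays for the compression from at most `4 * n` points to `n`.
  obtain ⟨k, hk⟩ := exists_pow_lt_of_lt_one (show 0 < ε / 4 by positivity)
    (show (1 - 1 / 2000 : ℝ) < 1 by norm_num)
  refine ⟨5 ^ k, fun n hn => ?_⟩
  have : Nonempty (Fin n) := ⟨⟨0, hn⟩⟩
  set m := Nat.sqrt n + 1 with hm
  have : NeZero m := ⟨by omega⟩
  have h1 : n ≤ m * m := (Nat.lt_succ_sqrt n).le
  have h2 : m * m ≤ 4 * n := by
    have h3 := Nat.sqrt_le n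
    have h4 := Nat.sqrt_le_self n
    rw [hm]; nlinarith
  have hcard : Fintype.card (ZMod m × ZMod m) = m * m := by simp [ZMod.card]
  obtain ⟨e⟩ : Nonempty (Fin n ↪ ZMod m × ZMod m) :=
    Function.Embedding.nonempty_of_card_le (by rw [hcard, Fintype.card_fin]; exact h1)
  refine ⟨_, (((isBanded_torusAverage m).pow k).submatrix e).smul _, fun f =>
    ((approximatesMean_torusAverage_pow m k).compress e (K := 4) ?_ f).trans ?_⟩
  · rw [hcard, Fintype.card_fin]; exact_mod_cast h2
  · gcongr
    linarith

/-! ### Block diagonal operators. -/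

section BlockDiagonal

variable {ι : Type*} {W : ι → Type*} [∀ i, Fintype (W i)]

/-- The action of a block diagonal matrix with blocks `E i`. -/
def blockMulVec (E : ∀ i, Matrix (W i) (W i) ℂ) (F : (Σ i, W i) → ℂ) (x : Σ i, W i) : ℂ :=
  (E x.1 *ᵥ fun w => F ⟨x.1, w⟩) x.2

lemma sum_norm_blockMulVec_sq_le (E : ∀ i, Matrix (W i) (W i) ℂ) {c S : ℝ}
    (hE : ∀ i (f : W i → ℂ), ∑ v, ‖(E i *ᵥ f) v‖ ^ 2 ≤ c ^ 2 * ∑ v, ‖f v‖ ^ 2)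
    (F : (Σ i, W i) → ℂ) (hF : ∀ t : Finset (Σ i, W i), ∑ x ∈ t, ‖F x‖ ^ 2 ≤ S)
    (s : Finset (Σ i, W i)) :
    ∑ x ∈ s, ‖blockMulVec E F x‖ ^ 2 ≤ c ^ 2 * S := by
  classical
  -- A finite set meets finitely many blocks, so it can be enlarged to a finite union of whole
  -- blocks.
  calc ∑ x ∈ s, ‖blockMulVec E F x‖ ^ 2
      ≤ ∑ x ∈ (s.image Sigma.fst).sigma fun _ => Finset.univ, ‖blockMulVec E F x‖ ^ 2 :=
        Finset.sum_le_sum_of_subset_of_nonneg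
          (fun x hx => Finset.mem_sigma.2 ⟨Finset.mem_image_of_mem _ hx, Finset.mem_univ _⟩)
          fun _ _ _ => by positivity
    _ ≤ ∑ i ∈ s.image Sigma.fst, c ^ 2 * ∑ v, ‖F ⟨i, v⟩‖ ^ 2 := by
        rw [Finset.sum_sigma]
        exact Finset.sum_le_sum fun i _ => hE i fun v => F ⟨i, v⟩
    _ = c ^ 2 * ∑ x ∈ (s.image Sigma.fst).sigma fun _ => Finset.univ, ‖F x‖ ^ 2 := by
        rw [← Finset.mul_sum, Finset.sum_sigma]
    _ ≤ c ^ 2 * S := by gcongr; exact hF _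

/-- A uniformly bounded family of blocks defines a bounded block diagonal operator. -/
lemma exists_blockDiagonal (E : ∀ i, Matrix (W i) (W i) ℂ) {c : ℝ} (hc : 0 ≤ c)
    (hE : ∀ i (f : W i → ℂ), ∑ v, ‖(E i *ᵥ f) v‖ ^ 2 ≤ c ^ 2 * ∑ v, ‖f v‖ ^ 2) :
    ∃ T : ell2 (Σ i, W i) →L[ℂ] ell2 (Σ i, W i), ‖T‖ ≤ c ∧
      ∀ f x, T f x = blockMulVec E f x := by
  have hb : ∀ (f : ell2 (Σ i, W i)) (s : Finset (Σ i, W i)),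
      ∑ x ∈ s, ‖blockMulVec E f x‖ ^ 2 ≤ c ^ 2 * ‖f‖ ^ 2 := fun f s =>
    sum_norm_blockMulVec_sq_le E hE f (fun t => by
      have := lp.sum_rpow_le_norm_rpow (p := 2) (by norm_num) f t
      simpa using this) s
  let T₀ : ell2 (Σ i, W i) →ₗ[ℂ] ell2 (Σ i, W i) :=
    { toFun := fun f => ⟨blockMulVec E f,
        memℓp_gen' (C := c ^ 2 * ‖f‖ ^ 2) fun s => by simpa using hb f s⟩
      map_add' := fun f g => by
        ext x
        exact congrFun (mulVec_add (E x.1) (fun w => f ⟨x.1, w⟩) fun w => g ⟨x.1, w⟩) x.2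
      map_smul' := fun a f => by
        ext x
        exact congrFun (mulVec_smul (E x.1) a fun w => f ⟨x.1, w⟩) x.2 }
  have hT₀ : ∀ f x, T₀ f x = blockMulVec E f x := fun _ _ => rfl
  have hT : ∀ f, ‖T₀ f‖ ≤ c * ‖f‖ := fun f => by
    refine lp.norm_le_of_forall_sum_le (by norm_num) (by positivity) fun s => ?_
    have := hb f s
    rw [← mul_pow] at this
    simpa [hT₀] using this
  exact ⟨T₀.mkContinuous c hT, T₀.mkContinuous_norm_le hc hT, hT₀⟩

end BlockDiagonal

/-! ### The Laplacian of the union of complete graphs. -/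

lemma matrixOf_normalizedLaplacian_of_ne {V : Type*} (G : SimpleGraph V) [G.LocallyFinite]
    {v w : V} (h : v ≠ w) [Decidable (G.Adj v w)] :
    matrixOf (normalizedLaplacian G) v w =
      if G.Adj v w then -((1 / Real.sqrt (G.degree v * G.degree w) : ℝ) : ℂ) else 0 := by
  classical
  rw [matrixOf, normalizedLaplacian_apply]
  simp only [lp.coeFn_single, Pi.single_apply, if_neg h, mul_ite, mul_one, mul_zero,
    Finset.sum_ite_eq', SimpleGraph.mem_neighborFinset, zero_sub]
  split_ifs <;> simp

lemma unionOfCompleteGraphs_adj_mk {n : ℕ} {i j : Fin n} :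
    unionOfCompleteGraphs.Adj ⟨n, i⟩ ⟨n, j⟩ ↔ i ≠ j := by
  constructor
  · rintro ⟨k, a, b, h, h', hab⟩
    cases h
    cases h'
    exact hab
  · exact fun h => ⟨n, i, j, rfl, rfl, h⟩

lemma unionOfCompleteGraphs_fst_eq_of_adj {x y : Σ n : ℕ, Fin n}
    (h : unionOfCompleteGraphs.Adj x y) : x.1 = y.1 := by
  obtain ⟨k, a, b, rfl, rfl, _⟩ := h
  rfl

lemma unionOfCompleteGraphs_degree {n : ℕ} (i : Fin n) :
    unionOfCompleteGraphs.degree ⟨n, i⟩ = n - 1 := by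
  classical
  have : unionOfCompleteGraphs.neighborFinset ⟨n, i⟩ =
      (Finset.univ.erase i).map (Function.Embedding.sigmaMk n) := by
    ext ⟨k, j⟩
    rw [SimpleGraph.mem_neighborFinset, Finset.mem_map]
    constructor
    · intro h
      obtain rfl : n = k := unionOfCompleteGraphs_fst_eq_of_adj h
      exact ⟨j, by simpa using (unionOfCompleteGraphs_adj_mk.1 h).symm, rfl⟩
    · rintro ⟨a, ha, h⟩
      cases h
      exact unionOfCompleteGraphs_adj_mk.2 (by simpa using (Finset.ne_of_mem_erase ha).symm)
  rw [← SimpleGraph.card_neighborFinset_eq_degree, this, Finset.card_map,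
    Finset.card_erase_of_mem (Finset.mem_univ i), Finset.card_univ, Fintype.card_fin]

/-- Adding to the Laplacian the block diagonal operator with blocks `n / (n - 1) • (Pₙ - Cₙ)` gives
an operator whose off-diagonal entries are supported on those of the `Cₙ`. -/
theorem isAULF_of_approximatesMean
    (h : ∀ ε : ℝ, 0 < ε → ∃ d : ℕ, ∀ n : ℕ, 1 ≤ n → ∃ C : Matrix (Fin n) (Fin n) ℂ,
      IsBanded d C ∧ ApproximatesMean C ε) :
    IsAULF unionOfCompleteGraphs := by
  classical
  refine Metric.mem_closure_iff.2 fun ε hε => ?_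
  obtain ⟨d, hd⟩ := h (ε / 4) (by positivity)
  have hd' : ∀ n : ℕ, ∃ C : Matrix (Fin n) (Fin n) ℂ, IsBanded d C ∧
      ApproximatesMean C (ε / 4) := fun n => by
    rcases Nat.eq_zero_or_pos n with rfl | hn
    · exact ⟨0, ⟨fun v => v.elim0, fun v => v.elim0⟩, fun f => by simp⟩
    · exact hd n hn
  choose C hC hC' using hd'
  -- At `n = 1` division by zero gives `r 1 = 0`, which is harmless: `K_1` has no off-diagonal
  -- entries. The bound `‖r n‖ ≤ 2` is attained at `n = 2`.
  let r : ℕ → ℂ := fun n => n / (n - 1)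
  have hr : ∀ n, ‖r n‖ ≤ 2 := fun n => by
    match n with
    | 0 => simp [r]
    | 1 => simp [r]
    | n + 2 =>
      have e : r (n + 2) = (((n + 2 : ℝ) / (n + 1) : ℝ) : ℂ) := by
        simp only [r]; push_cast; ring
      rw [e, Complex.norm_real, Real.norm_of_nonneg (by positivity), div_le_iff₀ (by positivity)]
      have : (0 : ℝ) ≤ n := Nat.cast_nonneg n
      linarith
  let E : ∀ n, Matrix (Fin n) (Fin n) ℂ := fun n => r n • (of (fun _ _ => (n : ℂ)⁻¹) - C n)
  obtain ⟨T, hT, hTE⟩ := exists_blockDiagonal E (c := ε / 2) (by positivity) fun n f => by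
    have e : ∀ v, ‖(E n *ᵥ f) v‖ ^ 2 = ‖r n‖ ^ 2 *
        ‖(∑ w, f w) / Fintype.card (Fin n) - (C n *ᵥ f) v‖ ^ 2 := fun v => by
      rw [← mul_pow, ← norm_mul, smul_mulVec, Pi.smul_apply, sub_mulVec, Pi.sub_apply, smul_eq_mul]
      congr 4
      simp [mulVec, dotProduct, ← Finset.mul_sum, div_eq_inv_mul]
    simp only [e, ← Finset.mul_sum]
    calc ‖r n‖ ^ 2 * _ ≤ 2 ^ 2 * ((ε / 4) ^ 2 * ∑ v, ‖f v‖ ^ 2) := by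
          gcongr
          · exact hr n
          · exact hC' n f
      _ = _ := by ring
  have hM : ∀ x y, matrixOf (normalizedLaplacian unionOfCompleteGraphs + T) x y =
      matrixOf (normalizedLaplacian unionOfCompleteGraphs) x y + matrixOf T x y := fun _ _ => rfl
  have hT_ne : ∀ x y : (Σ n : ℕ, Fin n), x.1 ≠ y.1 → matrixOf T x y = 0 := fun x y hxy => by
    rw [matrixOf, hTE, blockMulVec, mulVec, dotProduct]
    refine Finset.sum_eq_zero fun w _ => ?_
    have : (⟨x.1, w⟩ : Σ n : ℕ, Fin n) ≠ y := by
      rintro rfl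
      exact hxy rfl
    simp [this]
  have hT_mk : ∀ (n : ℕ) (i j : Fin n), matrixOf T ⟨n, i⟩ ⟨n, j⟩ = E n i j := fun n i j => by
    rw [matrixOf, hTE]
    simp [blockMulVec, mulVec, dotProduct, Pi.single_apply]
  have hB_ne : ∀ x y : (Σ n : ℕ, Fin n), x.1 ≠ y.1 →
      matrixOf (normalizedLaplacian unionOfCompleteGraphs + T) x y = 0 := fun x y hxy => by
    rw [hM, hT_ne x y hxy,
      matrixOf_normalizedLaplacian_of_ne _ fun h => hxy (congrArg Sigma.fst h),
      if_neg fun h => hxy (unionOfCompleteGraphs_fst_eq_of_adj h), add_zero]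
  -- The Laplacian entry `-1 / (n - 1)` cancels the contribution `r n * n⁻¹` of `P_n`, leaving only
  -- the entry from `C n`.
  have hB_mk : ∀ (n : ℕ) (i j : Fin n), i ≠ j →
      matrixOf (normalizedLaplacian unionOfCompleteGraphs + T) ⟨n, i⟩ ⟨n, j⟩ =
        -(r n * C n i j) := fun n i j hij => by
    have hn : 2 ≤ n := by
      have := i.2; have := j.2; have := Fin.val_ne_of_ne hij; omega
    rw [hM, hT_mk, matrixOf_normalizedLaplacian_of_ne _ (fun h => hij (by simpa using h)),
      if_pos (unionOfCompleteGraphs_adj_mk.2 hij), unionOfCompleteGraphs_degree,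
      unionOfCompleteGraphs_degree, Real.sqrt_mul_self (Nat.cast_nonneg _),
      Nat.cast_sub (by omega)]
    have h0 : (n : ℂ) ≠ 0 := Nat.cast_ne_zero.2 (by omega)
    have h1 : (n : ℂ) - 1 ≠ 0 := sub_ne_zero.2 (by exact_mod_cast (by omega : n ≠ 1))
    simp only [E, r, Matrix.smul_apply, Matrix.sub_apply, of_apply, smul_eq_mul]
    push_cast
    field_simp
    ring
  -- The bound `d + 1` leaves room for the diagonal entry, where no cancellation is claimed.
  have hcard : ∀ (x : Σ n : ℕ, Fin n) (s : Set (Σ n : ℕ, Fin n)) (t : Set (Fin x.1)),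
      t.encard ≤ d → s ⊆ insert x (Sigma.mk x.1 '' t) → s.encard ≤ (d + 1 : ℕ) :=
    fun x s t ht hs => by
      refine (Set.encard_le_encard hs).trans ((Set.encard_insert_le _ _).trans ?_)
      push_cast
      gcongr
      exact (Set.encard_image_le _ _).trans ht
  refine ⟨normalizedLaplacian unionOfCompleteGraphs + T,
    Set.mem_iUnion.2 ⟨d + 1, fun x => hcard x _ _ ((hC x.1).1 x.2) ?_,
      fun x => hcard x _ _ ((hC x.1).2 x.2) ?_⟩, ?_⟩
  · rintro ⟨k, j⟩ hy
    obtain ⟨n, i⟩ := x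
    obtain rfl : n = k := by_contra fun h => hy (hB_ne _ _ h)
    by_cases hij : i = j
    · exact Or.inl (by rw [hij])
    · refine Or.inr ⟨j, fun h => hy ?_, rfl⟩
      rw [hB_mk n i j hij, h, mul_zero, neg_zero]
  · rintro ⟨k, j⟩ hy
    obtain ⟨n, i⟩ := x
    obtain rfl : k = n := by_contra fun h => hy (hB_ne _ _ h)
    by_cases hij : j = i
    · exact Or.inl (by rw [hij])
    · refine Or.inr ⟨j, fun h => hy ?_, rfl⟩
      rw [hB_mk k j i hij, h, mul_zero, neg_zero]
  · rw [dist_eq_norm, sub_add_cancel_left, norm_neg]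
    linarith

/-! ### From the mean to the operator norm of `P_n - C_n`. -/

lemma constProjection_apply (n : ℕ) (f : EuclideanSpace ℂ (Fin n)) (v : Fin n) :
    constProjection n f v = (∑ w, f w) / Fintype.card (Fin n) := by
  rw [constProjection, Submodule.starProjection_singleton]
  simp [EuclideanSpace.norm_sq_eq, PiLp.inner_apply]

lemma ApproximatesMean.norm_constProjection_sub_le {n : ℕ} {C : Matrix (Fin n) (Fin n) ℂ} {ε : ℝ}
    (hε : 0 ≤ ε) (h : ApproximatesMean C ε) :
    ‖constProjection n - Matrix.toEuclideanCLM (𝕜 := ℂ) C‖ ≤ ε := by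
  refine ContinuousLinearMap.opNorm_le_bound _ hε fun f => ?_
  refine abs_le_of_sq_le_sq' ?_ (by positivity) |>.2
  rw [mul_pow, EuclideanSpace.norm_sq_eq, EuclideanSpace.norm_sq_eq]
  simpa [constProjection_apply, Matrix.ofLp_toEuclideanCLM] using h f

end ApproxULF
end

/-- The disjoint union of all complete graphs is approximately uniformly locally finite, and,
equivalently, the projections `P_n` are approximated uniformly in `n` (in the operator norm of
`ℂⁿ`) by matrices with boundedly many nonzero entries in each row and column. -/
theorem proposition2p1 :
    ApproxULF.IsAULF ApproxULF.unionOfCompleteGraphs ∧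
    ∀ ε : ℝ, 0 < ε → ∃ d : ℕ, ∀ n : ℕ, 1 ≤ n → ∃ C : Matrix (Fin n) (Fin n) ℂ,
      ApproxULF.IsBanded d C ∧
      ‖ApproxULF.constProjection n - Matrix.toEuclideanCLM (𝕜 := ℂ) C‖ < ε := by
  refine ⟨ApproxULF.isAULF_of_approximatesMean fun ε hε =>
    ApproxULF.exists_banded_approximatesMean hε, fun ε hε => ?_⟩
  obtain ⟨d, hd⟩ := ApproxULF.exists_banded_approximatesMean (half_pos hε)
  refine ⟨d, fun n hn => ?_⟩
  obtain ⟨C, hC, hC'⟩ := hd n hn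
  exact ⟨C, hC, (hC'.norm_constProjection_sub_le (half_pos hε).le).trans_lt (half_lt_self hε)⟩
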